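/- Theorem 3.2 (Output Noise Model: Sufficiency). For integers $k,n\ge 1$ and $\beta\ge 0$ let $\mathrm{Supp}(X)=\{j: X_j\neq 0\}$ for $X\in\mathbb R^n$, $\Xi^{\{k\}}=\{X\in\mathbb R^n: |\mathrm{Supp}(X)|\le k\}$ and $\Xi^{\{k\}}_\beta=\{X\in\Xi^{\{k\}}: |X_j|\ge\beta \text{ for all } j\in \mathrm{Supp}(X)\}$. One observes $Y=GX+N/\sqrt{SNR}$, where $G\in\mathbb R^{m\times n}$ is known, $X\in\Xi^{\{k\}}_\beta$ with $\beta>0$, and $N\sim\mathcal N(0,I_m)$ is independent of $G$. The (relaxed) maximum-likelihood decoder outputs $\mathrm{Supp}(\hat X)$ for a minimizer $\hat X$ of $\|Y-GX'\|_2^2$ over $X'\in\Xi^{\{k\}}_{\beta/2}$; it recovers the support if a minimizer exists and every minimizer has support $\mathrm{Supp}(X)$. Let $P(G)$ be the infimum over $X\in\Xi^{\{k\}}_\beta$ of the probability, over $N$, that the support of $X$ is recovered. Let $H_2(q)=-q\log q-(1-q)\log(1-q)$ and $\log$ be the natural logarithm. (a) Gaussian matrices. There are absolute constants $C_1,C_2>0$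 such that for every $\varepsilon>0$ there is $n_0$ such that, for all $n\ge n_0$, all $k\ge 1$ with $\alpha_n=k/n\le 0.04$, all $m\ge C_1\,k\log(n/k)$, all $\beta>0$ and all $SNR\ge C_2\log(n)/\beta^2$: if $G$ has IID $\mathcal N(0,1/m)$ entries, then $\mathbf E_G\,P(G)\ge 1-\varepsilon$. Moreover the requirements $m=\Omega(nH_2(k/n))$ and $m=\Omega(k\log(n/k))$ agree: $k\log(n/k)\le nH_2(k/n)\le 2k\log(n/k)$ whenever $k,n\geq 1$ and $k/n\le 0.04$. (b) Deterministic matrices. For every $c>0$ there is $C>0$ such that for every $\varepsilon>0$ there is $n_0$ such that, for all $n\ge n_0$, all $k\ge1$, all $m\ge 2k+1$, all $\beta>0$, all $SNR\ge C\log(n)/\beta^2$ and every $G\in\mathbb R^{m\times n}$ whose columns have unit Euclidean norm and which satisfies $$\sigma_{G,\min}=\min_{0\neq X\in\Xi^{\{2k\}}}\frac{\|GX\|_2^2}{\|X\|_2^2}\ \ge\ c,$$ we have $P(G)\ge 1-\varepsilon$. -/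

import Mathlib

open MeasureTheory ProbabilityTheory Filter
open scoped ENNReal NNReal

noncomputable section

/-- The Euclidean norm of a real coordinate vector. -/
def l2norm {d : ℕ} (v : Fin d → ℝ) : ℝ := ‖WithLp.toLp 2 v‖

/-- The support `{j | X j ≠ 0}` of a signal. -/
def supp {n : ℕ} (X : Fin n → ℝ) : Finset (Fin n) := Finset.univ.filter (fun j => X j ≠ 0)

/-- The `k`-sparse signals in `ℝⁿ`: at most `k` nonzero entries. -/
def sparseSignals (n k : ℕ) : Set (Fin n → ℝ) := {X | (supp X).card ≤ k}

/-- The `k`-sparse signals in `ℝⁿ` all of whose nonzero entries have absolute value at least `β`. -/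
def boundedSparseSignals (n k : ℕ) (β : ℝ) : Set (Fin n → ℝ) :=
  {X | (supp X).card ≤ k ∧ ∀ j ∈ supp X, β ≤ |X j|}

/-- The restricted minimum singular value over `2k`-sparse vectors: the infimum of
`‖G X‖² / ‖X‖²` over all nonzero `2k`-sparse `X` (it is attained if `1 ≤ k` and `1 ≤ n`). -/
def sigmaMin {m n : ℕ} (G : Matrix (Fin m) (Fin n) ℝ) (k : ℕ) : ℝ :=
  sInf {r : ℝ | ∃ X ∈ sparseSignals n (2 * k), X ≠ 0 ∧
    r = l2norm (G.mulVec X) ^ 2 / l2norm X ^ 2}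

/-- The output noise model `Y = G X + N / √SNR`. -/
def observation {m n : ℕ} (G : Matrix (Fin m) (Fin n) ℝ) (SNR : ℝ)
    (X : Fin n → ℝ) (N : Fin m → ℝ) : Fin m → ℝ :=
  fun i => G.mulVec X i + N i / √SNR

/-- `Xhat` is an output of the relaxed maximum-likelihood decoder on the observation `Y`: it
minimizes `‖Y - G X‖²` over the `k`-sparse signals with nonzero entries at least `β / 2` in
absolute value. -/
def IsRelaxedML {m n : ℕ} (G : Matrix (Fin m) (Fin n) ℝ) (k : ℕ) (β : ℝ)
    (Y : Fin m → ℝ) (Xhat : Fin n → ℝ) : Prop :=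
  Xhat ∈ boundedSparseSignals n k (β / 2) ∧
    ∀ X ∈ boundedSparseSignals n k (β / 2),
      l2norm (Y - G.mulVec Xhat) ^ 2 ≤ l2norm (Y - G.mulVec X) ^ 2

/-- The decoder recovers the support of `X₀` from `Y`: it has an output, and every possible output
(however ties are broken) has the support of `X₀`. -/
def RecoversSupport {m n : ℕ} (G : Matrix (Fin m) (Fin n) ℝ) (k : ℕ) (β : ℝ)
    (Y : Fin m → ℝ) (X₀ : Fin n → ℝ) : Prop :=
  (∃ Xhat, IsRelaxedML G k β Y Xhat) ∧ ∀ Xhat, IsRelaxedML G k β Y Xhat → supp Xhat = supp X₀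

/-- The law of the noise: IID standard Gaussian entries. -/
def noiseLaw (m : ℕ) : Measure (Fin m → ℝ) := Measure.pi fun _ => gaussianReal 0 1

/-- The law of an `m × n` matrix with IID `𝒩(0, 1/m)` entries. -/
def gaussianEnsemble (m n : ℕ) : Measure (Fin m → Fin n → ℝ) :=
  Measure.pi fun _ => Measure.pi fun _ => gaussianReal 0 (1 / (m : ℝ≥0))

/-- The worst-case probability of exact support recovery given `G`, i.e. the infimum over all
signals `X` in the signal class of the probability (over the noise) that the support of `X` is
recovered from the observation. -/
def worstCaseRecoveryProb {m n : ℕ} (G : Matrix (Fin m) (Fin n) ℝ) (k : ℕ) (β SNR : ℝ) : ℝ≥0∞ :=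
  ⨅ X ∈ boundedSparseSignals n k β,
    noiseLaw m {N | RecoversSupport G k β (observation G SNR X N) X}

end

/-! Fix the true support `S`, a competing support `T`, and put `U = S ∩ T`, `A = symmDiff S T`.
Projecting out the columns in `U` leaves a signal difference living on `A`. There every entry is at
least `β / 2` in size, so the lower restricted isometry gives it squared norm at least `c β² |A| /
4`. The noise enters only through its projection on a space of dimension at most `|A|`. If that
projection has squared norm below `(c β² / 16) |A|`, then `T` cannot beat the least squares fit on
`S` (`supp_eq_of_norm_le`). The same smallness, applied to `S` with one index removed, shows that
this fit is off by at most `β / 2` per coordinate (`exists_leastSquares`). Hence it is feasible for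
the relaxed decoder, which is why the threshold is lowered to `β / 2`.

A chi-square tail bounds the failure for each `T` by `q ^ |A|`, and summing over all `T` gives `(1 +
q) ^ n - 1`. An SNR of order `log n / β²` makes `q ≤ 2 / n²`, uniformly in the signal and in `k`.
This proves the deterministic part.

For Gaussian matrices it remains to prove the lower isometry (`gaussianEnsemble_not_lowerRIP_le`).
Sparse vectors are rounded to a grid, where a union bound over integer vectors suffices.
Derandomized rounding controls the error by column norms alone, so no upper isometry over sparse
vectors is needed. -/

/-- The vectors vanishing outside the index set `A`. -/
def supportedOn {n : ℕ} (A : Finset (Fin n)) : Submodule ℝ (Fin n → ℝ) where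
  carrier := {X | ∀ j ∉ A, X j = 0}
  add_mem' := by
    intro X Y hX hY j hj
    simp [hX j hj, hY j hj]
  zero_mem' := by simp
  smul_mem' := by
    intro c X hX j hj
    simp [hX j hj]

theorem mem_supportedOn {n : ℕ} {A : Finset (Fin n)} {X : Fin n → ℝ} :
    X ∈ supportedOn A ↔ ∀ j ∉ A, X j = 0 := Iff.rfl

theorem mem_supp {n : ℕ} {X : Fin n → ℝ} {j : Fin n} : j ∈ supp X ↔ X j ≠ 0 := by
  simp [supp]

theorem supp_subset_iff {n : ℕ} {A : Finset (Fin n)} {X : Fin n → ℝ} :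
    supp X ⊆ A ↔ X ∈ supportedOn A := by
  simp only [Finset.subset_iff, mem_supp, mem_supportedOn]
  exact forall_congr' fun j => by tauto

theorem mem_supportedOn_supp {n : ℕ} (X : Fin n → ℝ) : X ∈ supportedOn (supp X) :=
  supp_subset_iff.1 subset_rfl

theorem card_supp_le {n : ℕ} {A : Finset (Fin n)} {X : Fin n → ℝ} (h : X ∈ supportedOn A) :
    (supp X).card ≤ A.card :=
  Finset.card_le_card (supp_subset_iff.2 h)

/-! ### Deterministic recovery from a lower isometry and small projected noise. -/

section Deterministic

variable {n : ℕ} {E : Type*} [NormedAddCommGroup E] [InnerProductSpace ℝ E]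
  [FiniteDimensional ℝ E]

/-- The span of the columns of `L` with index in `A`. -/
def columnSpan (L : (Fin n → ℝ) →ₗ[ℝ] E) (A : Finset (Fin n)) : Submodule ℝ E :=
  (supportedOn A).map L

/-- The span of the columns of `L` with index in `A`, after projecting out the columns with
index in `U`. -/
noncomputable def residualSpan (L : (Fin n → ℝ) →ₗ[ℝ] E) (U A : Finset (Fin n)) : Submodule ℝ E :=
  (supportedOn A).map ((columnSpan L U)ᗮ.starProjection.toLinearMap ∘ₗ L)

theorem finrank_supportedOn_le (A : Finset (Fin n)) :
    Module.finrank ℝ (supportedOn A) ≤ A.card := by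
  classical
  have hle : supportedOn A ≤
      Submodule.span ℝ ((A.image fun j => Pi.single j (1 : ℝ) : Finset (Fin n → ℝ)) :
        Set (Fin n → ℝ)) := by
    intro X hX
    have hX' : X = ∑ j ∈ A, X j • Pi.single j (1 : ℝ) := by
      ext i
      simp only [Finset.sum_apply, Pi.smul_apply, Pi.single_apply, smul_eq_mul, mul_ite, mul_one,
        mul_zero, Finset.sum_ite_eq]
      split_ifs with h
      · rfl
      · exact hX i h
    rw [hX']
    refine Submodule.sum_mem _ fun j hj => Submodule.smul_mem _ _ (Submodule.subset_span ?_)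
    simp only [Finset.coe_image]
    exact ⟨j, hj, rfl⟩
  exact (Submodule.finrank_mono hle).trans
    ((finrank_span_finset_le_card _).trans Finset.card_image_le)

theorem finrank_residualSpan_le (L : (Fin n → ℝ) →ₗ[ℝ] E) (U A : Finset (Fin n)) :
    Module.finrank ℝ (residualSpan L U A) ≤ A.card :=
  (Submodule.finrank_map_le _ _).trans (finrank_supportedOn_le A)

/-- Lower restricted isometry at sparsity level `s`. -/
def LowerRIP (L : (Fin n → ℝ) →ₗ[ℝ] E) (s : ℕ) (c : ℝ) : Prop :=
  ∀ X : Fin n → ℝ, (supp X).card ≤ s → c * ∑ j, X j ^ 2 ≤ ‖L X‖ ^ 2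

theorem residual_eq (L : (Fin n → ℝ) →ₗ[ℝ] E) (U : Finset (Fin n)) (D : Fin n → ℝ) :
    ∃ u ∈ supportedOn U, (columnSpan L U)ᗮ.starProjection (L D) = L (D - u) := by
  obtain ⟨u, hu, huL⟩ := (columnSpan L U).starProjection_apply_mem (L D)
  refine ⟨u, hu, ?_⟩
  rw [Submodule.starProjection_orthogonal_val, map_sub, huL]

/-- The projection subtracts the image of some `u` supported on `U`. Since `U` and `A` are disjoint,
`D - u` agrees with `D` on `A`, and the isometry bound for `D - u` only loses the entries on `U`. -/
theorem LowerRIP.residual {L : (Fin n → ℝ) →ₗ[ℝ] E} {s : ℕ} {c : ℝ} (h : LowerRIP L s c)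
    (hc : 0 ≤ c) {U A : Finset (Fin n)} (hUA : Disjoint U A) (hs : (U ∪ A).card ≤ s)
    {D : Fin n → ℝ} (hD : D ∈ supportedOn A) :
    c * ∑ j ∈ A, D j ^ 2 ≤ ‖(columnSpan L U)ᗮ.starProjection (L D)‖ ^ 2 := by
  obtain ⟨u, hu, hres⟩ := residual_eq L U D
  rw [hres]
  refine le_trans ?_ (h (D - u) ?_)
  · refine mul_le_mul_of_nonneg_left ?_ hc
    calc ∑ j ∈ A, D j ^ 2 = ∑ j ∈ A, (D - u) j ^ 2 := by
          refine Finset.sum_congr rfl fun j hj => ?_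
          simp [hu j (Finset.disjoint_right.1 hUA hj)]
      _ ≤ _ := Finset.sum_le_sum_of_subset_of_nonneg (Finset.subset_univ _)
          fun _ _ _ => sq_nonneg _
  · refine (card_supp_le (A := U ∪ A) fun j hj => ?_).trans hs
    simp only [Finset.mem_union, not_or] at hj
    simp [hu j hj.1, hD j hj.2]

/-- This is the dimension reduction: against a residual signal, only the noise component in a space
of dimension at most `|A|` counts. -/
theorem residual_inner (L : (Fin n → ℝ) →ₗ[ℝ] E) {U A : Finset (Fin n)} {D : Fin n → ℝ}
    (hD : D ∈ supportedOn A) (W : E) :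
    inner ℝ W ((columnSpan L U)ᗮ.starProjection (L D)) =
      inner ℝ ((residualSpan L U A).starProjection W)
        ((columnSpan L U)ᗮ.starProjection (L D)) := by
  have hmem : (columnSpan L U)ᗮ.starProjection (L D) ∈ residualSpan L U A := ⟨D, hD, rfl⟩
  have := (residualSpan L U A).starProjection_inner_eq_zero W _ hmem
  rw [inner_sub_left] at this
  linarith

/-- The residual noise in all the directions separating `S` from another support is small. -/
def SmallResidualNoise (L : (Fin n → ℝ) →ₗ[ℝ] E) (S : Finset (Fin n)) (τ : ℝ) (W : E) : Prop :=
  ∀ T : Finset (Fin n), T ≠ S →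
    ‖(residualSpan L (S ∩ T) (symmDiff S T)).starProjection W‖ ^ 2 < τ * (symmDiff S T).card

/-- The least squares estimate on the true support is accurate in every coordinate. -/
theorem exists_leastSquares {L : (Fin n → ℝ) →ₗ[ℝ] E} {s : ℕ} {c β : ℝ} (h : LowerRIP L s c)
    (hc : 0 < c) (hβ : 0 < β) {S : Finset (Fin n)} (hS : S.card ≤ s) {W : E}
    (hW : SmallResidualNoise L S (c * β ^ 2 / 16) W) :
    ∃ Z ∈ supportedOn S, L Z = (columnSpan L S).starProjection W ∧ ∀ j, |Z j| ≤ β / 2 := by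
  obtain ⟨Z, hZ, hLZ⟩ := (columnSpan L S).starProjection_apply_mem W
  refine ⟨Z, hZ, hLZ, fun j => ?_⟩
  by_cases hj : j ∈ S
  swap
  · rw [hZ j hj, abs_zero]; positivity
  -- Taking `T = S \ {j}` makes the residual span at most a line, which isolates coordinate `j` of
  -- the fit.
  have hST : S ∩ S.erase j = S.erase j := Finset.inter_eq_right.2 (Finset.erase_subset _ _)
  have hΔ : symmDiff S (S.erase j) = {j} := by
    ext i; simp only [Finset.mem_symmDiff, Finset.mem_erase, Finset.mem_singleton]
    by_cases hij : i = j
    · subst hij; simp [hj]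
    · simp [hij]
  have hne : S.erase j ≠ S := fun e => by
    have := Finset.notMem_erase j S
    rw [e] at this; exact this hj
  have hN := hW _ hne
  simp only [hST, hΔ, Finset.card_singleton] at hN
  set U := S.erase j with hU
  have he : (Pi.single j (1 : ℝ) : Fin n → ℝ) ∈ supportedOn {j} := fun i hi => by
    simp only [Finset.mem_singleton] at hi
    simp [hi]
  have hnorm := h.residual (U := U) (A := {j}) hc.le (by simp [hU])
    (by rw [show U ∪ {j} = S by rw [hU, Finset.union_comm, ← Finset.insert_eq,
      Finset.insert_erase hj]]; exact hS) he
  simp only [Finset.sum_singleton, Pi.single_eq_same, one_pow, mul_one] at hnorm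
  set v := (columnSpan L U)ᗮ.starProjection (L (Pi.single j 1)) with hv
  have hvZ : inner ℝ (L Z) v = Z j * ‖v‖ ^ 2 := by
    have hdec : L Z = L (Z - Z j • Pi.single j 1) + Z j • L (Pi.single j 1) := by
      rw [← map_smul, ← map_add, sub_add_cancel]
    have hmem : L (Z - Z j • Pi.single j 1) ∈ columnSpan L U := by
      refine ⟨_, fun i hi => ?_, rfl⟩
      by_cases hij : i = j
      · subst hij; simp
      · have : i ∉ S := fun h' => hi (Finset.mem_erase.2 ⟨hij, h'⟩)
        simp [hij, hZ i this]
    have hvmem : v ∈ (columnSpan L U)ᗮ := Submodule.starProjection_apply_mem _ _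
    have h1 := (columnSpan L U)ᗮ.starProjection_inner_eq_zero (L (Pi.single j 1)) v hvmem
    rw [hdec, inner_add_left, (Submodule.mem_orthogonal _ _).1 hvmem _ hmem, zero_add,
      real_inner_smul_left]
    rw [inner_sub_left, ← hv, real_inner_self_eq_norm_sq] at h1
    rw [show inner ℝ (L (Pi.single j 1)) v = ‖v‖ ^ 2 by linarith]
  have hvW : inner ℝ (L Z) v = inner ℝ W v := by
    obtain ⟨u, hu, hres⟩ := residual_eq L U (Pi.single j 1)
    have hvS : v ∈ columnSpan L S := by
      rw [hv, hres]
      refine ⟨_, fun i hi => ?_, rfl⟩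
      have h1 : i ≠ j := fun e => hi (e ▸ hj)
      simp [h1, hu i (fun h' => hi (Finset.mem_of_mem_erase h'))]
    have := (columnSpan L S).starProjection_inner_eq_zero W v hvS
    rw [inner_sub_left] at this
    rw [hLZ]; linarith
  have hQ := residual_inner L (U := U) he W
  rw [← hv] at hQ
  have hCS := abs_real_inner_le_norm ((residualSpan L U {j}).starProjection W) v
  rw [← hQ, ← hvW, hvZ, abs_mul, abs_of_nonneg (sq_nonneg ‖v‖)] at hCS
  set q := ‖(residualSpan L U {j}).starProjection W‖
  have hvpos : 0 < ‖v‖ := by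
    rcases (norm_nonneg v).eq_or_lt with h0 | h0
    · rw [← h0] at hnorm; norm_num at hnorm; linarith
    · exact h0
  have h2 : |Z j| * ‖v‖ ≤ q := by
    refine le_of_mul_le_mul_right ?_ hvpos
    linarith [hCS]
  have h3 : |Z j| ^ 2 * c ≤ q ^ 2 := by
    calc |Z j| ^ 2 * c ≤ |Z j| ^ 2 * ‖v‖ ^ 2 := by gcongr
      _ = (|Z j| * ‖v‖) ^ 2 := by ring
      _ ≤ q ^ 2 := by gcongr
  -- The noise level would even give `β / 4`; feasibility of the fit only needs `β / 2`.
  have h4 : |Z j| ^ 2 ≤ (β / 2) ^ 2 := by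
    refine le_of_mul_le_mul_right (h3.trans (hN.le.trans ?_)) hc
    have : 0 ≤ c * β ^ 2 := by positivity
    push_cast
    nlinarith
  exact (sq_le_sq₀ (abs_nonneg _) (by positivity)).1 h4

/-- A sparse competitor with large entries and residual no larger than that of the least squares
fit on the true support has the true support. -/
theorem supp_eq_of_norm_le {L : (Fin n → ℝ) →ₗ[ℝ] E} {k : ℕ} {c β : ℝ} (h : LowerRIP L (2 * k) c)
    (hc : 0 < c) (hβ : 0 < β) {X X' : Fin n → ℝ} (hX : X ∈ boundedSparseSignals n k β)
    (hX' : X' ∈ boundedSparseSignals n k (β / 2)) {W : E}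
    (hW : SmallResidualNoise L (supp X) (c * β ^ 2 / 16) W)
    (hle : ‖W + L (X - X')‖ ≤ ‖W - (columnSpan L (supp X)).starProjection W‖) :
    supp X' = supp X := by
  by_contra hne
  set S := supp X with hS
  set T := supp X' with hT
  have hN := hW T hne
  set U := S ∩ T with hU
  set A := symmDiff S T with hA
  have hUA : Disjoint U A := by
    rw [Finset.disjoint_left]
    intro i; simp only [hU, hA, Finset.mem_inter, Finset.mem_symmDiff]; tauto
  have hUnion : (U ∪ A).card ≤ 2 * k := by
    have : U ∪ A ⊆ S ∪ T := by
      intro i; simp only [hU, hA, Finset.mem_union, Finset.mem_inter, Finset.mem_symmDiff]; tauto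
    have h1 := Finset.card_le_card this
    have h2 := Finset.card_union_le S T
    have h3 : S.card ≤ k := hX.1
    have h4 : T.card ≤ k := hX'.1
    omega
  set D := X - X' with hD
  set DA : Fin n → ℝ := fun j => if j ∈ A then D j else 0 with hDA
  have hDAmem : DA ∈ supportedOn A := fun j hj => by simp [hDA, hj]
  have hlow := h.residual hc.le hUA hUnion hDAmem
  set P := (columnSpan L U)ᗮ.starProjection with hP
  set v := P (L DA) with hv
  -- `D` vanishes off `S ∪ T`, so `D - DA` lives on `U` and is killed by `P`.
  have hPD : P (L D) = v := by
    have hDU : D - DA ∈ supportedOn U := fun j hj => by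
      by_cases hjA : j ∈ A
      · simp [hDA, hjA]
      · have h1 : j ∉ S ∧ j ∉ T := by
          simp only [hU, hA, Finset.mem_inter, Finset.mem_symmDiff] at hj hjA; tauto
        have h2 : X j = 0 := by simpa [hS, mem_supp] using h1.1
        have h3 : X' j = 0 := by simpa [hT, mem_supp] using h1.2
        simp [hDA, hjA, hD, h2, h3]
    have : P (L (D - DA)) = 0 := by
      rw [hP, Submodule.starProjection_orthogonal_val,
        Submodule.starProjection_eq_self_iff.2
          (show L (D - DA) ∈ columnSpan L U from Submodule.mem_map_of_mem hDU), sub_self]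
    rw [map_sub, map_sub, sub_eq_zero] at this
    exact this
  -- Projecting on the larger space `columnSpan L S` leaves the smaller residual.
  have hupper : ‖W - (columnSpan L S).starProjection W‖ ≤ ‖P W‖ := by
    rw [hP, Submodule.starProjection_orthogonal_val]
    have hUS : columnSpan L U ≤ columnSpan L S :=
      Submodule.map_mono fun x hx j hj => hx j fun h' => hj (Finset.mem_inter.1 h').1
    have hmem : (columnSpan L U).starProjection W ∈ columnSpan L S :=
      hUS (Submodule.starProjection_apply_mem _ _)
    rw [Submodule.starProjection_minimal]
    exact ciInf_le ⟨0, by rintro _ ⟨x, rfl⟩; exact norm_nonneg _⟩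
      (⟨_, hmem⟩ : columnSpan L S)
  have hlower : ‖P W + v‖ ≤ ‖W + L D‖ := by
    rw [← hPD, ← map_add]
    exact Submodule.norm_starProjection_apply_le _ _
  have hsq : ‖P W + v‖ ^ 2 ≤ ‖P W‖ ^ 2 := by
    gcongr; exact hlower.trans (hle.trans hupper)
  rw [norm_add_sq_real] at hsq
  have hinner : inner ℝ (P W) v = inner ℝ W v := by
    have := (columnSpan L U)ᗮ.starProjection_inner_eq_zero W v
      (Submodule.starProjection_apply_mem _ _)
    rw [inner_sub_left] at this
    linarith
  have hQ := residual_inner L (U := U) hDAmem W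
  rw [← hP, ← hv] at hQ
  have hCS := abs_real_inner_le_norm ((residualSpan L U A).starProjection W) v
  rw [← hQ] at hCS
  set q := ‖(residualSpan L U A).starProjection W‖
  have hv2 : ‖v‖ ^ 2 ≤ 2 * (q * ‖v‖) := by
    have := neg_abs_le (inner ℝ W v)
    rw [hinner] at hsq
    linarith
  have hvq : ‖v‖ ^ 2 ≤ 4 * q ^ 2 := by nlinarith [sq_nonneg (‖v‖ - 2 * q)]
  -- On `A` exactly one of `X j`, `X' j` is nonzero; the weaker of the two thresholds is `β / 2`.
  have hDlow : (A.card : ℝ) * (β / 2) ^ 2 ≤ ∑ j ∈ A, DA j ^ 2 := by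
    rw [← nsmul_eq_mul, ← Finset.sum_const]
    refine Finset.sum_le_sum fun j hj => ?_
    simp only [hDA, hj, if_true, hD, Pi.sub_apply]
    rw [← sq_abs (X j - X' j)]
    gcongr
    rcases Finset.mem_symmDiff.1 hj with ⟨h1, h2⟩ | ⟨h1, h2⟩
    · have h3 : X' j = 0 := by simpa [hT, mem_supp] using h2
      rw [h3, sub_zero]
      linarith [hX.2 j h1]
    · have h3 : X j = 0 := by simpa [hS, mem_supp] using h2
      rw [h3, zero_sub, abs_neg]
      exact hX'.2 j h1
  -- The contradiction: `c |A| β² / 4 ≤ ‖v‖² ≤ 4 q² < 4 (c β² / 16) |A|`.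
  have := mul_le_mul_of_nonneg_left hDlow hc.le
  nlinarith

end Deterministic

/-! ### Chi-square tails for projected Gaussian noise. -/

section ChiSquare

theorem lintegral_exp_mul_sq_gaussianReal {a : ℝ} (ha : a < 1 / 2) :
    ∫⁻ x, ENNReal.ofReal (Real.exp (a * x ^ 2)) ∂(gaussianReal 0 1) =
      ENNReal.ofReal (√(1 - 2 * a))⁻¹ := by
  have hb : 0 < 1 / 2 - a := by linarith
  rw [gaussianReal_of_var_ne_zero 0 one_ne_zero,
    lintegral_withDensity_eq_lintegral_mul _ (measurable_gaussianPDF 0 1) (by fun_prop)]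
  have hfun : ∀ x : ℝ, (gaussianPDF 0 1 * fun x => ENNReal.ofReal (Real.exp (a * x ^ 2))) x =
      ENNReal.ofReal ((√(2 * Real.pi))⁻¹ * Real.exp (-(1 / 2 - a) * x ^ 2)) := by
    intro x
    rw [Pi.mul_apply, gaussianPDF, ← ENNReal.ofReal_mul (gaussianPDFReal_nonneg _ _ _),
      gaussianPDFReal_def]
    congr 1
    simp only [NNReal.coe_one, mul_one, sub_zero]
    rw [mul_assoc, ← Real.exp_add]
    congr 2
    ring
  simp_rw [hfun]
  rw [← ofReal_integral_eq_lintegral_ofReal ((integrable_exp_neg_mul_sq hb).const_mul _)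
    (ae_of_all _ fun x => by positivity), integral_const_mul, integral_gaussian]
  congr 1
  rw [← Real.sqrt_inv, ← Real.sqrt_inv, ← Real.sqrt_mul (by positivity)]
  congr 1
  have := Real.pi_ne_zero
  have h2 : 1 - 2 * a ≠ 0 := by linarith
  have h3 : 1 / 2 - a ≠ 0 := hb.ne'
  field_simp

theorem lintegral_exp_mul_sum_sq_noiseLaw (d : ℕ) {a : ℝ} (ha : a < 1 / 2) :
    ∫⁻ x, ENNReal.ofReal (Real.exp (a * ∑ i, x i ^ 2)) ∂(noiseLaw d) =
      ENNReal.ofReal (√(1 - 2 * a))⁻¹ ^ d := by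
  have hind : iIndepFun (fun (i : Fin d) (x : Fin d → ℝ) =>
      ENNReal.ofReal (Real.exp (a * x i ^ 2))) (noiseLaw d) :=
    iIndepFun_pi (X := fun _ (x : ℝ) => ENNReal.ofReal (Real.exp (a * x ^ 2)))
      fun i => by fun_prop
  have h := lintegral_prod_eq_prod_lintegral_of_indepFun Finset.univ _ hind (fun i => by fun_prop)
  have h1 : ∀ i : Fin d, ∫⁻ x, ENNReal.ofReal (Real.exp (a * x i ^ 2)) ∂(noiseLaw d) =
      ENNReal.ofReal (√(1 - 2 * a))⁻¹ := fun i => by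
    rw [← lintegral_exp_mul_sq_gaussianReal ha]
    exact (measurePreserving_eval (fun _ : Fin d => gaussianReal 0 1) i).lintegral_comp
      (f := fun x => ENNReal.ofReal (Real.exp (a * x ^ 2))) (by fun_prop)
  simp_rw [h1, Finset.prod_const, Finset.card_univ, Fintype.card_fin] at h
  rw [← h]
  refine lintegral_congr fun x => ?_
  rw [Finset.mul_sum, Real.exp_sum, ENNReal.ofReal_prod_of_nonneg fun _ _ => (Real.exp_pos _).le]

/-- Either sign of `a` is allowed, so one Chernoff bound yields both the upper and the lower tail.
-/
theorem noiseLaw_exp_markov (d : ℕ) {a : ℝ} (ha : a < 1 / 2) (t : ℝ) :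
    noiseLaw d {x | t ≤ a * ∑ i, x i ^ 2} ≤
      ENNReal.ofReal ((√(1 - 2 * a))⁻¹ ^ d * Real.exp (-t)) := by
  have h := meas_ge_le_lintegral_div (μ := noiseLaw d)
    (f := fun x => ENNReal.ofReal (Real.exp (a * ∑ i, x i ^ 2)))
    (Measurable.aemeasurable (by fun_prop))
    (ε := ENNReal.ofReal (Real.exp t)) (by simp [Real.exp_pos]) ENNReal.ofReal_ne_top
  rw [lintegral_exp_mul_sum_sq_noiseLaw d ha, ← ENNReal.ofReal_pow (by positivity),
    ← ENNReal.ofReal_div_of_pos (Real.exp_pos t)] at h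
  rw [Real.exp_neg, ← div_eq_mul_inv]
  refine le_trans (measure_mono fun x hx => ?_) h
  exact ENNReal.ofReal_le_ofReal (Real.exp_le_exp.2 hx)

theorem noiseLaw_sum_sq_ge (d : ℕ) (t : ℝ) :
    noiseLaw d {x | t ≤ ∑ i, x i ^ 2} ≤ ENNReal.ofReal (2 ^ d * Real.exp (-(t / 4))) := by
  refine le_trans (measure_mono fun x hx => ?_)
    ((noiseLaw_exp_markov d (a := 1 / 4) (by norm_num) (t / 4)).trans
      (ENNReal.ofReal_le_ofReal ?_))
  · simp only [Set.mem_ofPred_eq] at hx ⊢; linarith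
  · gcongr
    rw [inv_le_comm₀ (by positivity) (by norm_num)]
    exact Real.le_sqrt_of_sq_le (by norm_num)

theorem noiseLaw_sum_sq_le (d : ℕ) (t : ℝ) :
    noiseLaw d {x | ∑ i, x i ^ 2 ≤ t} ≤
      ENNReal.ofReal ((1 / 2) ^ d * Real.exp (3 / 2 * t)) := by
  refine le_trans (measure_mono fun x hx => ?_)
    ((noiseLaw_exp_markov d (a := -(3 / 2)) (by norm_num) (-(3 / 2 * t))).trans
      (ENNReal.ofReal_le_ofReal ?_))
  · simp only [Set.mem_ofPred_eq] at hx ⊢; linarith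
  · rw [neg_neg, show (1 : ℝ) - 2 * -(3 / 2) = 2 ^ 2 by norm_num,
      Real.sqrt_sq (by norm_num), one_div]

/-- The projection of standard Gaussian noise on a subspace is standard Gaussian. -/
theorem map_orthogonalProjection_noiseLaw {m : ℕ} (V : Submodule ℝ (EuclideanSpace ℝ (Fin m))) :
    (noiseLaw m).map (fun N => V.orthogonalProjectionOnto (WithLp.toLp 2 N)) = stdGaussian V := by
  have hcomp : (fun N : Fin m → ℝ => V.orthogonalProjectionOnto (WithLp.toLp 2 N)) =
      V.orthogonalProjectionOnto ∘ WithLp.toLp 2 := rfl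
  rw [hcomp, ← Measure.map_map (by fun_prop) (by fun_prop), noiseLaw, map_pi_eq_stdGaussian]
  refine Measure.ext_of_charFun ?_
  ext t
  rw [charFun_stdGaussian, charFun_apply, integral_map (by fun_prop) (by fun_prop)]
  have := charFun_stdGaussian (t : EuclideanSpace ℝ (Fin m))
  rw [charFun_apply] at this
  refine Eq.trans ?_ this
  refine integral_congr_ae (ae_of_all _ fun x => ?_)
  simp only
  -- Pairing with `t ∈ V` does not see the projection, so the two characteristic functions agree.
  rw [Submodule.inner_orthogonalProjectionOnto_eq_of_mem_right]

theorem noiseLaw_norm_starProjection_ge {m : ℕ} (V : Submodule ℝ (EuclideanSpace ℝ (Fin m)))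
    {d : ℕ} (hd : Module.finrank ℝ V ≤ d) (t : ℝ) :
    noiseLaw m {N | t ≤ ‖V.starProjection (WithLp.toLp 2 N)‖ ^ 2} ≤
      ENNReal.ofReal (2 ^ d * Real.exp (-(t / 4))) := by
  have hset : {N | t ≤ ‖V.starProjection (WithLp.toLp 2 N)‖ ^ 2} =
      (fun N : Fin m → ℝ => V.orthogonalProjectionOnto (WithLp.toLp 2 N)) ⁻¹'
        {w : V | t ≤ ‖w‖ ^ 2} := by
    ext N
    simp only [Set.mem_ofPred_eq, Set.mem_preimage, Submodule.starProjection_apply,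
      Submodule.coe_norm]
  have hmeas : MeasurableSet {w : V | t ≤ ‖w‖ ^ 2} :=
    measurableSet_le measurable_const (by fun_prop)
  rw [hset, ← Measure.map_apply (by fun_prop) hmeas, map_orthogonalProjection_noiseLaw,
    stdGaussian, Measure.map_apply (by fun_prop) hmeas]
  have hset2 : (fun x : Fin (Module.finrank ℝ V) → ℝ => ∑ i, x i • stdOrthonormalBasis ℝ V i) ⁻¹'
      {w : V | t ≤ ‖w‖ ^ 2} = {x | t ≤ ∑ i, x i ^ 2} := by
    ext x
    simp only [Set.mem_preimage, Set.mem_ofPred_eq]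
    rw [← (stdOrthonormalBasis ℝ V).sum_sq_norm_inner_right]
    simp [Orthonormal.inner_right_fintype (stdOrthonormalBasis ℝ V).orthonormal]
  rw [hset2]
  refine (noiseLaw_sum_sq_ge _ t).trans (ENNReal.ofReal_le_ofReal ?_)
  gcongr
  norm_num

end ChiSquare

/-! ### Existence of the decoder output and the union bound over supports. -/

section Recovery

theorem l2norm_sq {d : ℕ} (v : Fin d → ℝ) : l2norm v ^ 2 = ∑ i, v i ^ 2 := by
  rw [l2norm, EuclideanSpace.real_norm_sq_eq]

theorem l2norm_nonneg {d : ℕ} (v : Fin d → ℝ) : 0 ≤ l2norm v := norm_nonneg _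

/-- The sensing matrix as a linear map into Euclidean space. -/
noncomputable def sensingMap {m n : ℕ} (G : Matrix (Fin m) (Fin n) ℝ) :
    (Fin n → ℝ) →ₗ[ℝ] EuclideanSpace ℝ (Fin m) :=
  (WithLp.linearEquiv 2 ℝ (Fin m → ℝ)).symm.toLinearMap ∘ₗ G.mulVecLin

theorem sensingMap_apply {m n : ℕ} (G : Matrix (Fin m) (Fin n) ℝ) (X : Fin n → ℝ) :
    sensingMap G X = WithLp.toLp 2 (G.mulVec X) := rfl

theorem norm_sensingMap {m n : ℕ} (G : Matrix (Fin m) (Fin n) ℝ) (X : Fin n → ℝ) :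
    ‖sensingMap G X‖ = l2norm (G.mulVec X) := rfl

theorem lowerRIP_of_le_sigmaMin {m n : ℕ} {G : Matrix (Fin m) (Fin n) ℝ} {k : ℕ} {c : ℝ}
    (h : c ≤ sigmaMin G k) : LowerRIP (sensingMap G) (2 * k) c := by
  intro X hX
  by_cases h0 : X = 0
  · simp [h0]
  rw [← l2norm_sq, norm_sensingMap]
  have hpos : 0 < l2norm X ^ 2 := by
    have : 0 < l2norm X := by
      rw [l2norm, norm_pos_iff]
      simpa using h0
    positivity
  rw [← le_div_iff₀ hpos]
  refine h.trans (csInf_le ⟨0, ?_⟩ ⟨X, hX, h0, rfl⟩)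
  rintro r ⟨Y, -, -, rfl⟩
  positivity

/-- Fixing a candidate set `A` containing the support turns the conditions into closed ones, and
there are finitely many `A`. -/
theorem isClosed_boundedSparseSignals (n k : ℕ) (β : ℝ) :
    IsClosed (boundedSparseSignals n k β) := by
  have hset : boundedSparseSignals n k β =
      ⋃ A ∈ (Finset.univ.filter fun A : Finset (Fin n) => A.card ≤ k),
        {X : Fin n → ℝ | (∀ j ∉ A, X j = 0) ∧ ∀ j ∈ A, β ≤ |X j|} := by
    ext X
    simp only [boundedSparseSignals, Finset.mem_filter, Finset.mem_univ, true_and,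
      Set.mem_iUnion, Set.mem_ofPred_eq, exists_prop]
    constructor
    · rintro ⟨h1, h2⟩
      exact ⟨supp X, h1, mem_supportedOn_supp X, h2⟩
    · rintro ⟨A, hA, h1, h2⟩
      have hsub : supp X ⊆ A := supp_subset_iff.2 h1
      exact ⟨(Finset.card_le_card hsub).trans hA, fun j hj => h2 j (hsub hj)⟩
  rw [hset]
  refine Set.Finite.isClosed_biUnion (Finset.finite_toSet _) fun A _ => ?_
  have e : {X : Fin n → ℝ | (∀ j ∉ A, X j = 0) ∧ ∀ j ∈ A, β ≤ |X j|} =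
      (⋂ j, ⋂ (_ : j ∉ A), {X | X j = 0}) ∩ ⋂ j, ⋂ (_ : j ∈ A), {X | β ≤ |X j|} := by
    ext X; simp
  rw [e]
  refine IsClosed.inter ?_ ?_
  · exact isClosed_iInter fun j => isClosed_iInter fun _ =>
      isClosed_eq (continuous_apply j) continuous_const
  · exact isClosed_iInter fun j => isClosed_iInter fun _ =>
      isClosed_le continuous_const (continuous_apply j).abs

/-- The feasible set is closed but unbounded. The lower isometry makes the objective coercive on it,
so the minimum may be sought among points doing no worse than the feasible point `0`. -/
theorem exists_isRelaxedML {m n : ℕ} {G : Matrix (Fin m) (Fin n) ℝ} {k : ℕ} {c β : ℝ}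
    (h : LowerRIP (sensingMap G) (2 * k) c) (hc : 0 < c) (Y : Fin m → ℝ) :
    ∃ Xhat, IsRelaxedML G k β Y Xhat := by
  set F := boundedSparseSignals n k (β / 2) with hF
  have hclosed : IsClosed F := isClosed_boundedSparseSignals n k _
  have hcont : Continuous fun X : Fin n → ℝ => l2norm (Y - G.mulVec X) ^ 2 := by
    simp only [l2norm_sq, Pi.sub_apply, Matrix.mulVec, dotProduct]
    fun_prop
  have h0 : (0 : Fin n → ℝ) ∈ F := by simp [hF, boundedSparseSignals, supp]
  set K := F ∩ {X | l2norm (Y - G.mulVec X) ^ 2 ≤ l2norm Y ^ 2} with hK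
  have hKc : IsCompact K := by
    refine Metric.isCompact_of_isClosed_isBounded
      (hclosed.inter (isClosed_le hcont continuous_const)) ?_
    refine (Metric.isBounded_iff_subset_closedBall 0).2
      ⟨√((2 * l2norm Y) ^ 2 / c), fun X hX => ?_⟩
    have hY0 : 0 ≤ l2norm Y := norm_nonneg _
    have h1 : l2norm (Y - G.mulVec X) ≤ l2norm Y :=
      (sq_le_sq₀ (norm_nonneg _) hY0).1 hX.2
    have h2 : ‖sensingMap G X‖ ≤ 2 * l2norm Y := by
      have e : sensingMap G X = WithLp.toLp 2 Y - WithLp.toLp 2 (Y - G.mulVec X) := by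
        rw [← WithLp.toLp_sub, sub_sub_cancel, sensingMap_apply]
      rw [e]
      refine (norm_sub_le _ _).trans ?_
      change l2norm Y + l2norm (Y - G.mulVec X) ≤ _
      linarith
    have h3 := h X (by have : (supp X).card ≤ k := hX.1.1; omega)
    have h4 : ∑ j, X j ^ 2 ≤ (2 * l2norm Y) ^ 2 / c := by
      rw [le_div_iff₀ hc, mul_comm]
      exact h3.trans (by gcongr)
    rw [mem_closedBall_zero_iff, pi_norm_le_iff_of_nonneg (Real.sqrt_nonneg _)]
    intro j
    refine Real.le_sqrt_of_sq_le (le_trans ?_ h4)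
    rw [Real.norm_eq_abs, sq_abs]
    exact Finset.single_le_sum (f := fun j => X j ^ 2) (fun _ _ => sq_nonneg _)
      (Finset.mem_univ j)
  obtain ⟨Xhat, hX, hmin⟩ := hKc.exists_isMinOn ⟨0, h0, by simp⟩ hcont.continuousOn
  refine ⟨Xhat, hX.1, fun X hXF => ?_⟩
  by_cases hXK : l2norm (Y - G.mulVec X) ^ 2 ≤ l2norm Y ^ 2
  · exact hmin ⟨hXF, hXK⟩
  · exact hX.2.trans (not_le.1 hXK).le

theorem recoversSupport_of_smallResidualNoise {m n : ℕ} {G : Matrix (Fin m) (Fin n) ℝ} {k : ℕ}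
    {c β SNR : ℝ} (h : LowerRIP (sensingMap G) (2 * k) c) (hc : 0 < c) (hβ : 0 < β)
    {X : Fin n → ℝ} (hX : X ∈ boundedSparseSignals n k β) {N : Fin m → ℝ}
    (hN : SmallResidualNoise (sensingMap G) (supp X) (c * β ^ 2 / 16)
      (WithLp.toLp 2 fun i => N i / √SNR)) :
    RecoversSupport G k β (observation G SNR X N) X := by
  refine ⟨exists_isRelaxedML h hc _, fun Xhat hXhat => ?_⟩
  have hcard : (supp X).card ≤ k := hX.1
  set W : EuclideanSpace ℝ (Fin m) := WithLp.toLp 2 fun i => N i / √SNR with hW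
  have hobs : ∀ X', l2norm (observation G SNR X N - G.mulVec X') =
      ‖W + sensingMap G (X - X')‖ := by
    intro X'
    rw [map_sub, sensingMap_apply, sensingMap_apply, hW, l2norm, ← WithLp.toLp_sub,
      ← WithLp.toLp_add]
    congr 2
    ext i
    simp only [observation, Pi.sub_apply, Pi.add_apply]
    ring
  obtain ⟨Z, hZ, hLZ, hZle⟩ := exists_leastSquares h hc hβ (by omega) hN
  have hZX : ∀ j ∉ supp X, (X + Z) j = 0 := fun j hj => by
    simp [hZ j hj, mem_supportedOn_supp X j hj]
  have hsub : supp (X + Z) ⊆ supp X := supp_subset_iff.2 hZX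
  have hmem : X + Z ∈ boundedSparseSignals n k (β / 2) := by
    refine ⟨(Finset.card_le_card hsub).trans hcard, fun j hj => ?_⟩
    have h1 := hX.2 j (hsub hj)
    have h2 := abs_sub_abs_le_abs_sub (X j) (-Z j)
    rw [abs_neg, sub_neg_eq_add] at h2
    rw [Pi.add_apply]
    linarith [hZle j]
  refine supp_eq_of_norm_le h hc hβ hX hXhat.1 hN ?_
  have hle := hXhat.2 _ hmem
  rw [hobs, hobs, sub_add_cancel_left, map_neg, hLZ, ← sub_eq_add_neg] at hle
  exact (sq_le_sq₀ (norm_nonneg _) (norm_nonneg _)).1 hle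

/-- Only subadditivity is used, so `A` need not be measurable; measurability of the recovery event
is never required. -/
theorem ofReal_one_sub_le_of_compl_le {Ω : Type*} [MeasurableSpace Ω] (μ : Measure Ω)
    [IsProbabilityMeasure μ] {A : Set Ω} {δ : ℝ} (h : μ Aᶜ ≤ ENNReal.ofReal δ) (hδ : 0 ≤ δ) :
    ENNReal.ofReal (1 - δ) ≤ μ A := by
  rw [ENNReal.ofReal_sub _ hδ, ENNReal.ofReal_one, tsub_le_iff_right]
  calc (1 : ℝ≥0∞) = μ (A ∪ Aᶜ) := by simp
    _ ≤ μ A + μ Aᶜ := measure_union_le _ _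
    _ ≤ _ := by gcongr

theorem noiseLaw_not_smallResidualNoise_le {m n : ℕ}
    (L : (Fin n → ℝ) →ₗ[ℝ] EuclideanSpace ℝ (Fin m)) (S : Finset (Fin n)) {τ SNR : ℝ}
    (hSNR : 0 < SNR) :
    noiseLaw m {N | ¬ SmallResidualNoise L S τ (WithLp.toLp 2 fun i => N i / √SNR)} ≤
      ENNReal.ofReal ((1 + 2 * Real.exp (-(τ * SNR / 4))) ^ n - 1) := by
  classical
  set q := 2 * Real.exp (-(τ * SNR / 4)) with hq
  have hsub : {N | ¬ SmallResidualNoise L S τ (WithLp.toLp 2 fun i => N i / √SNR)} ⊆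
      ⋃ T ∈ Finset.univ.erase S, {N : Fin m → ℝ | τ * SNR * (symmDiff S T).card ≤
        ‖(residualSpan L (S ∩ T) (symmDiff S T)).starProjection (WithLp.toLp 2 N)‖ ^ 2} := by
    intro N hN
    simp only [SmallResidualNoise, Set.mem_ofPred_eq, not_forall, not_lt] at hN
    obtain ⟨T, hT, hle⟩ := hN
    simp only [Set.mem_iUnion, Finset.mem_erase, Finset.mem_univ, and_true, exists_prop,
      Set.mem_ofPred_eq]
    refine ⟨T, hT, ?_⟩
    have hs : WithLp.toLp 2 (fun i => N i / √SNR) = (√SNR)⁻¹ • WithLp.toLp 2 N := by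
      rw [← WithLp.toLp_smul]
      congr 1
      ext i
      simp [div_eq_inv_mul]
    rw [hs, map_smul, norm_smul, mul_pow, Real.norm_eq_abs, sq_abs, inv_pow,
      Real.sq_sqrt hSNR.le, inv_mul_eq_div, le_div_iff₀ hSNR] at hle
    linarith
  have hq0 : 0 ≤ q := by positivity
  calc _ ≤ ∑ T ∈ Finset.univ.erase S, noiseLaw m {N : Fin m → ℝ |
        τ * SNR * (symmDiff S T).card ≤
        ‖(residualSpan L (S ∩ T) (symmDiff S T)).starProjection (WithLp.toLp 2 N)‖ ^ 2} :=
        (measure_mono hsub).trans (measure_biUnion_finset_le _ _)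
    _ ≤ ∑ T ∈ Finset.univ.erase S, ENNReal.ofReal (q ^ (symmDiff S T).card) := by
        refine Finset.sum_le_sum fun T _ => (noiseLaw_norm_starProjection_ge _
          (finrank_residualSpan_le L _ _) _).trans (le_of_eq ?_)
        rw [hq, mul_pow, ← Real.exp_nat_mul]
        congr 3
        ring
    _ = ENNReal.ofReal (∑ T ∈ Finset.univ.erase S, q ^ (symmDiff S T).card) :=
        (ENNReal.ofReal_sum_of_nonneg fun _ _ => by positivity).symm
    _ = ENNReal.ofReal ((1 + q) ^ n - 1) := by
        congr 1
        rw [Finset.sum_erase_eq_sub (Finset.mem_univ S), symmDiff_self]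
        congr 1
        -- `T ↦ symmDiff S T` is a bijection, so the sum is the binomial expansion of `(1 + q) ^ n`,
        -- whatever `S` is.
        have h1 : ∑ T : Finset (Fin n), q ^ (symmDiff S T).card =
            ∑ A : Finset (Fin n), q ^ A.card :=
          Fintype.sum_equiv (symmDiff_right_involutive S).toPerm _ _ fun _ => rfl
        have h2 := Finset.sum_pow_mul_eq_add_pow q 1 (Finset.univ : Finset (Fin n))
        rw [h1, add_comm (1 : ℝ) q, ← Finset.powerset_univ]
        simpa using h2

theorem ofReal_one_sub_le_worstCaseRecoveryProb {m n : ℕ} {G : Matrix (Fin m) (Fin n) ℝ} {k : ℕ}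
    {c β SNR : ℝ} (h : LowerRIP (sensingMap G) (2 * k) c) (hc : 0 < c) (hβ : 0 < β)
    (hn : 2 ≤ n) (hSNR : 128 / c * Real.log n / β ^ 2 ≤ SNR) :
    ENNReal.ofReal (1 - 4 / n) ≤ worstCaseRecoveryProb G k β SNR := by
  have hn2 : (2 : ℝ) ≤ n := by exact_mod_cast hn
  have hn0 : (0 : ℝ) < n := by linarith
  have hlog : 0 < Real.log n := Real.log_pos (by linarith)
  have hSNR0 : 0 < SNR := lt_of_lt_of_le (by positivity) hSNR
  refine le_iInf₂ fun X hX => ?_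
  have : IsProbabilityMeasure (noiseLaw m) := by unfold noiseLaw; infer_instance
  refine ofReal_one_sub_le_of_compl_le _ ?_ (by positivity)
  have hsub : {N | RecoversSupport G k β (observation G SNR X N) X}ᶜ ⊆
      {N | ¬ SmallResidualNoise (sensingMap G) (supp X) (c * β ^ 2 / 16)
        (WithLp.toLp 2 fun i => N i / √SNR)} := fun N hN hsmall =>
    hN (recoversSupport_of_smallResidualNoise h hc hβ hX hsmall)
  refine (measure_mono hsub).trans ((noiseLaw_not_smallResidualNoise_le (sensingMap G) (supp X)
    hSNR0).trans (ENNReal.ofReal_le_ofReal ?_))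
  -- The exponent is `c β² SNR / 64`, so the constant `128 / c` makes it at least `2 log n`.
  have hexp : Real.exp (-(c * β ^ 2 / 16 * SNR / 4)) ≤ ((n : ℝ) ^ 2)⁻¹ := by
    have h1 : 128 / c * Real.log n ≤ SNR * β ^ 2 := (div_le_iff₀ (by positivity)).1 hSNR
    have h2 : 128 * Real.log n ≤ c * (SNR * β ^ 2) := by
      rw [div_mul_eq_mul_div, div_le_iff₀ hc] at h1
      linarith
    rw [← Real.exp_log hn0, ← Real.exp_nat_mul, ← Real.exp_neg]
    refine Real.exp_le_exp.2 ?_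
    push_cast
    nlinarith
  have hle1 : (2 : ℝ) / n ≤ 1 := by rw [div_le_one hn0]; exact hn2
  calc (1 + 2 * Real.exp (-(c * β ^ 2 / 16 * SNR / 4))) ^ n - 1
      ≤ (1 + 2 * ((n : ℝ) ^ 2)⁻¹) ^ n - 1 := by gcongr
    _ ≤ Real.exp (2 * ((n : ℝ) ^ 2)⁻¹) ^ n - 1 := by
        gcongr; rw [add_comm]; exact Real.add_one_le_exp _
    _ = Real.exp (2 / n) - 1 := by
        rw [← Real.exp_nat_mul]; congr 2; field_simp
    _ ≤ 4 / n := by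
        have := Real.abs_exp_sub_one_le (x := 2 / n)
          (by rwa [abs_of_pos (by positivity)])
        rw [abs_of_pos (a := 2 / (n : ℝ)) (by positivity)] at this
        have h3 := le_abs_self (Real.exp (2 / n) - 1)
        have : (4 : ℝ) / n = 2 * (2 / n) := by ring
        linarith

end Recovery

/-! ### Concentration of the image of a fixed vector under a Gaussian matrix. -/

section GaussianConcentration

theorem map_sum_mul_pi_gaussianReal {n : ℕ} (v : ℝ≥0) (y : Fin n → ℝ) :
    (Measure.pi fun _ : Fin n => gaussianReal 0 v).map (fun x => ∑ j, y j * x j) =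
      gaussianReal 0 (v * ∑ j, (y j ^ 2).toNNReal) := by
  have := Measure.isProbabilityMeasure_map (μ := Measure.pi fun _ : Fin n => gaussianReal 0 v)
    (f := fun x => ∑ j, y j * x j) (Measurable.aemeasurable (by fun_prop))
  refine Measure.ext_of_charFun ?_
  ext t
  rw [charFun_apply_real, integral_map (Measurable.aemeasurable (by fun_prop)) (by fun_prop),
    charFun_gaussianReal]
  have h1 : ∀ x : Fin n → ℝ, Complex.exp (t * ((∑ j, y j * x j : ℝ) : ℂ) * Complex.I) =
      ∏ j, Complex.exp (((t * y j : ℝ) : ℂ) * x j * Complex.I) := by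
    intro x
    rw [← Complex.exp_sum]
    congr 1
    push_cast
    rw [Finset.mul_sum, Finset.sum_mul]
    exact Finset.sum_congr rfl fun j _ => by ring
  simp_rw [h1]
  rw [integral_fintype_prod_eq_prod
    (f := fun (j : Fin n) (x : ℝ) => Complex.exp (((t * y j : ℝ) : ℂ) * x * Complex.I))]
  simp_rw [← charFun_apply_real, charFun_gaussianReal]
  rw [← Complex.exp_sum]
  congr 1
  have h2 : ∀ j, (((y j ^ 2).toNNReal : ℝ) : ℂ) = (y j : ℂ) ^ 2 := fun j => by
    rw [Real.coe_toNNReal _ (sq_nonneg _)]; push_cast; rfl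
  push_cast
  simp only [h2, mul_zero, zero_mul, zero_sub, Finset.mul_sum, Finset.sum_mul, Finset.sum_div,
    Finset.sum_neg_distrib]
  congr 1
  exact Finset.sum_congr rfl fun j _ => by ring

/-- The image of a fixed vector under a Gaussian matrix is a multiple of standard Gaussian
noise. -/
theorem map_mulVec_gaussianEnsemble {m n : ℕ} (hm : 0 < m) {y : Fin n → ℝ}
    (hy : 0 < ∑ j, y j ^ 2) :
    (gaussianEnsemble m n).map
      (fun G i => √(m / ∑ j, y j ^ 2) * (Matrix.of G).mulVec y i) = noiseLaw m := by
  set r := √(m / ∑ j, y j ^ 2) with hr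
  have hm' : (0 : ℝ) < m := by exact_mod_cast hm
  have hrow : (Measure.pi fun _ : Fin n => gaussianReal 0 (1 / (m : ℝ≥0))).map
      (fun x => ∑ j, (r * y j) * x j) = gaussianReal 0 1 := by
    rw [map_sum_mul_pi_gaussianReal]
    congr 1
    apply NNReal.coe_injective
    push_cast
    simp_rw [fun j => Real.coe_toNNReal _ (sq_nonneg (r * y j)), mul_pow, ← Finset.mul_sum]
    rw [hr, Real.sq_sqrt (by positivity)]
    field_simp
  have hfun : (fun (G : Fin m → Fin n → ℝ) i => r * (Matrix.of G).mulVec y i) =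
      fun G i => (fun x : Fin n → ℝ => ∑ j, (r * y j) * x j) (G i) := by
    ext G i
    simp only [Matrix.mulVec, dotProduct, Matrix.of_apply, Finset.mul_sum]
    exact Finset.sum_congr rfl fun j _ => by ring
  have : ∀ _ : Fin m, SigmaFinite
      ((Measure.pi fun _ : Fin n => gaussianReal 0 (1 / (m : ℝ≥0))).map
        (fun x => ∑ j, (r * y j) * x j)) := fun _ => by rw [hrow]; infer_instance
  rw [hfun, gaussianEnsemble, Measure.pi_map_pi
    (f := fun _ (x : Fin n → ℝ) => ∑ j, (r * y j) * x j) (fun _ => Measurable.aemeasurable (by fun_prop))]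
  simp_rw [hrow]
  rfl

theorem gaussianEnsemble_mulVec_preimage {m n : ℕ} (hm : 0 < m) {y : Fin n → ℝ}
    (hy : 0 < ∑ j, y j ^ 2) {A : Set ℝ} (hA : MeasurableSet A) :
    gaussianEnsemble m n {G | (m / ∑ j, y j ^ 2) * ‖sensingMap (Matrix.of G) y‖ ^ 2 ∈ A} =
      noiseLaw m {x | ∑ i, x i ^ 2 ∈ A} := by
  rw [← map_mulVec_gaussianEnsemble hm hy, Measure.map_apply]
  · congr 1
    ext G
    simp only [Set.mem_preimage, Set.mem_ofPred_eq, mul_pow, ← Finset.mul_sum]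
    rw [Real.sq_sqrt (by positivity), norm_sensingMap, l2norm_sq]
  · simp only [Matrix.mulVec, dotProduct, Matrix.of_apply]
    fun_prop
  · exact (Finset.measurable_sum _ fun i _ => (measurable_pi_apply i).pow_const 2) hA

theorem gaussianEnsemble_norm_sq_le {m n : ℕ} (hm : 0 < m) {y : Fin n → ℝ}
    (hy : 0 < ∑ j, y j ^ 2) :
    gaussianEnsemble m n {G | ‖sensingMap (Matrix.of G) y‖ ^ 2 ≤ 1 / 4 * ∑ j, y j ^ 2} ≤
      ENNReal.ofReal (Real.exp (-(m / 4))) := by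
  have hm' : (0 : ℝ) < m := by exact_mod_cast hm
  refine le_trans (measure_mono fun G hG => ?_)
    ((gaussianEnsemble_mulVec_preimage hm hy (A := Set.Iic (m / 4)) measurableSet_Iic).le.trans
      ((noiseLaw_sum_sq_le m _).trans (ENNReal.ofReal_le_ofReal ?_)))
  · simp only [Set.mem_ofPred_eq, Set.mem_Iic] at hG ⊢
    rw [div_mul_eq_mul_div, div_le_iff₀ hy]
    nlinarith
  · rw [one_div, ← Real.exp_log (inv_pos.2 (zero_lt_two' ℝ)), ← Real.exp_nat_mul, ← Real.exp_add,
      Real.log_inv]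
    refine Real.exp_le_exp.2 ?_
    -- The claim is `log 2 - 3 / 8 ≥ 1 / 4`.
    nlinarith [Real.log_two_gt_d9]

theorem gaussianEnsemble_norm_sq_ge {m n : ℕ} (hm : 0 < m) {y : Fin n → ℝ}
    (hy : 0 < ∑ j, y j ^ 2) :
    gaussianEnsemble m n {G | 4 * ∑ j, y j ^ 2 ≤ ‖sensingMap (Matrix.of G) y‖ ^ 2} ≤
      ENNReal.ofReal (Real.exp (-(m / 4))) := by
  have hm' : (0 : ℝ) < m := by exact_mod_cast hm
  refine le_trans (measure_mono fun G hG => ?_)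
    ((gaussianEnsemble_mulVec_preimage hm hy (A := Set.Ici (4 * m)) measurableSet_Ici).le.trans
      ((noiseLaw_sum_sq_ge m _).trans (ENNReal.ofReal_le_ofReal ?_)))
  · simp only [Set.mem_ofPred_eq, Set.mem_Ici] at hG ⊢
    rw [div_mul_eq_mul_div, le_div_iff₀ hy]
    nlinarith
  · rw [← Real.exp_log (zero_lt_two' ℝ), ← Real.exp_nat_mul, ← Real.exp_add]
    refine Real.exp_le_exp.2 ?_
    -- The claim is `1 - log 2 ≥ 1 / 4`.
    nlinarith [Real.log_two_lt_d9]

end GaussianConcentration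

/-! ### Rounding sparse vectors to a grid. -/

section Rounding

variable {n : ℕ} {E : Type*} [NormedAddCommGroup E] [InnerProductSpace ℝ E]

/-- Round `x` up or down at random with mean `x`: the cross term averages to zero and the variance
is at most `h² / 4`, so one of the two choices is no worse than the average. -/
theorem exists_round_coordinate (p e : E) {h : ℝ} (hh : 0 < h) (x : ℝ) :
    ∃ z : ℤ, |h * z - x| ≤ h ∧
      ‖p + (h * z - x) • e‖ ^ 2 ≤ ‖p‖ ^ 2 + ‖e‖ ^ 2 * h ^ 2 / 4 := by
  have h1 : h * ⌊x / h⌋ ≤ x := by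
    have := Int.floor_le (x / h)
    rw [le_div_iff₀ hh] at this; linarith
  have h2 : x < h * ⌊x / h⌋ + h := by
    have := Int.lt_floor_add_one (x / h)
    rw [div_lt_iff₀ hh] at this; linarith
  have hexp : ∀ t : ℝ, ‖p + t • e‖ ^ 2 = ‖p‖ ^ 2 + 2 * t * inner ℝ p e + t ^ 2 * ‖e‖ ^ 2 := by
    intro t
    rw [norm_add_sq_real, real_inner_smul_right, norm_smul, mul_pow, Real.norm_eq_abs, sq_abs]
    ring
  set a := x - h * ⌊x / h⌋ with ha
  have ha0 : 0 ≤ a := by linarith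
  have hah : a < h := by linarith
  by_contra hcon
  push Not at hcon
  have hA := hcon ⌊x / h⌋ (by rw [abs_le]; constructor <;> linarith)
  have hB := hcon (⌊x / h⌋ + 1) (by push_cast; rw [abs_le]; constructor <;> nlinarith)
  push_cast at hB
  rw [hexp] at hA hB
  rw [show h * (⌊x / h⌋ : ℝ) - x = -a by linarith] at hA
  rw [show h * ((⌊x / h⌋ : ℝ) + 1) - x = h - a by linarith] at hB
  set c := inner ℝ p e
  have hA' : ‖e‖ ^ 2 * h ^ 2 / 4 < -(2 * a * c) + a ^ 2 * ‖e‖ ^ 2 := by linarith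
  have hB' : ‖e‖ ^ 2 * h ^ 2 / 4 < 2 * (h - a) * c + (h - a) ^ 2 * ‖e‖ ^ 2 := by linarith
  -- Weights `h - a` and `a`, the unnormalized rounding probabilities, cancel the terms in `c`.
  have hsum : h * (‖e‖ ^ 2 * h ^ 2 / 4) < h * (a * (h - a) * ‖e‖ ^ 2) := by
    have e1 := mul_lt_mul_of_pos_left hA' (sub_pos.2 hah)
    have e2 := mul_le_mul_of_nonneg_left hB'.le ha0
    nlinarith
  have h3 := lt_of_mul_lt_mul_left hsum hh.le
  nlinarith [mul_nonneg (sq_nonneg (h - 2 * a)) (sq_nonneg ‖e‖)]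

theorem exists_round_on (L : (Fin n → ℝ) →ₗ[ℝ] E) {h K : ℝ} (hh : 0 < h)
    (hcol : ∀ j, ‖L (Pi.single j 1)‖ ^ 2 ≤ K) (x : Fin n → ℝ) (A : Finset (Fin n)) :
    ∃ y : Fin n → ℝ, (∀ j ∈ A, ∃ z : ℤ, y j = h * z) ∧ (∀ j ∈ A, |y j - x j| ≤ h) ∧
      (∀ j ∉ A, y j = x j) ∧ ‖L y‖ ^ 2 ≤ ‖L x‖ ^ 2 + A.card * (K * h ^ 2 / 4) := by
  classical
  induction A using Finset.induction_on with
  | empty => exact ⟨x, by simp⟩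
  | insert a A ha ih =>
    obtain ⟨y, hz, hclose, hout, hbound⟩ := ih
    obtain ⟨z, hz1, hz2⟩ := exists_round_coordinate (L y) (L (Pi.single a 1)) hh (x a)
    have hy' : ∀ j, (y + (h * z - x a) • Pi.single a (1 : ℝ) : Fin n → ℝ) j =
        if j = a then h * z else y j := by
      intro j
      by_cases hj : j = a
      · subst hj; simp [hout j ha]
      · simp [hj]
    refine ⟨y + (h * z - x a) • Pi.single a 1, fun j hj => ?_, fun j hj => ?_, fun j hj => ?_, ?_⟩
    · rw [hy']
      split_ifs with hja
      · exact ⟨z, rfl⟩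
      · exact hz j ((Finset.mem_insert.1 hj).resolve_left hja)
    · rw [hy']
      split_ifs with hja
      · rw [hja]; exact hz1
      · exact hclose j ((Finset.mem_insert.1 hj).resolve_left hja)
    · rw [Finset.mem_insert, not_or] at hj
      rw [hy', if_neg hj.1]
      exact hout j hj.2
    · rw [map_add, map_smul, Finset.card_insert_of_notMem ha]
      have : ‖L (Pi.single a 1)‖ ^ 2 * h ^ 2 ≤ K * h ^ 2 :=
        mul_le_mul_of_nonneg_right (hcol a) (sq_nonneg h)
      push_cast
      linarith

/-- Rounding a sparse vector to a grid increases the norm of its image little. -/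
theorem exists_round (L : (Fin n → ℝ) →ₗ[ℝ] E) {h K : ℝ} (hh : 0 < h)
    (hcol : ∀ j, ‖L (Pi.single j 1)‖ ^ 2 ≤ K) (x : Fin n → ℝ) :
    ∃ z : Fin n → ℤ, (∀ j, x j = 0 → z j = 0) ∧ (∀ j, |h * z j - x j| ≤ h) ∧
      ‖L (fun j => h * z j)‖ ^ 2 ≤ ‖L x‖ ^ 2 + (supp x).card * (K * h ^ 2 / 4) := by
  obtain ⟨y, hz, hclose, hout, hbound⟩ := exists_round_on L hh hcol x (supp x)
  have hy0 : ∀ j ∉ supp x, y j = 0 := fun j hj => by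
    rw [hout j hj]; simpa [mem_supp] using hj
  have hz' : ∀ j, ∃ z : ℤ, y j = h * z := fun j => by
    by_cases hj : j ∈ supp x
    · exact hz j hj
    · exact ⟨0, by simp [hy0 j hj]⟩
  choose z hz using hz'
  have hyz : y = fun j => h * (z j : ℝ) := funext hz
  refine ⟨z, fun j hj => ?_, fun j => ?_, hyz ▸ hbound⟩
  · have h1 := hy0 j (by simp [mem_supp, hj])
    rw [hz] at h1
    simpa [hh.ne'] using h1
  · rw [← hz]
    by_cases hj : j ∈ supp x
    · exact hclose j hj
    · rw [hout j hj, sub_self, abs_zero]; exact hh.le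

/-- The integer vectors with at most `s` nonzero entries and squared norm at most `R`. -/
noncomputable def sparseIntegerVectors (n s R : ℕ) : Finset (Fin n → ℤ) :=
  (Fintype.piFinset fun _ => Finset.Icc (-(R : ℤ)) R).filter fun z =>
    (Finset.univ.filter fun j => z j ≠ 0).card ≤ s ∧ ∑ j, z j ^ 2 ≤ (R : ℤ)

theorem mem_sparseIntegerVectors {s R : ℕ} {z : Fin n → ℤ} :
    z ∈ sparseIntegerVectors n s R ↔
      (Finset.univ.filter fun j => z j ≠ 0).card ≤ s ∧ ∑ j, z j ^ 2 ≤ (R : ℤ) := by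
  simp only [sparseIntegerVectors, Finset.mem_filter, Fintype.mem_piFinset, Finset.mem_Icc,
    and_iff_right_iff_imp]
  rintro ⟨-, h⟩ j
  have h1 : z j ^ 2 ≤ ∑ j, z j ^ 2 :=
    Finset.single_le_sum (f := fun j => z j ^ 2) (fun _ _ => sq_nonneg _) (Finset.mem_univ j)
  have h2 := Int.le_self_sq (z j)
  have h3 := Int.le_self_sq (-z j)
  rw [neg_sq] at h3
  constructor <;> linarith

/-- Bounded columns and a lower bound on sparse integer vectors give a lower bound on all sparse
vectors. -/
theorem lowerRIP_of_sparseIntegerVectors (L : (Fin n → ℝ) →ₗ[ℝ] E) {s : ℕ}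
    (hcol : ∀ j, ‖L (Pi.single j 1)‖ ^ 2 ≤ 4)
    (hnet : ∀ z ∈ sparseIntegerVectors n s (25 * s),
      1 / 4 * ∑ j, (z j : ℝ) ^ 2 ≤ ‖L (fun j => (z j : ℝ))‖ ^ 2) :
    LowerRIP L s (5 / 64) := by
  intro x hx
  by_cases hx0 : x = 0
  · simp [hx0]
  have hd : 0 < (supp x).card := by
    rw [Finset.card_pos]
    obtain ⟨j, hj⟩ := Function.ne_iff.1 hx0
    exact ⟨j, mem_supp.2 hj⟩
  have hspos : (0 : ℝ) < s := by exact_mod_cast hd.trans_le hx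
  have hr0 : 0 < l2norm x := by
    rw [l2norm, norm_pos_iff]; simpa using hx0
  rw [← l2norm_sq]
  set r := l2norm x with hr
  set h := r / (4 * √s) with hh
  have hhpos : 0 < h := by positivity
  -- This step size keeps the rounding error below `r / 4`, so `‖y‖` lies between `3 r / 4` and `5 r
  -- / 4`; dividing by `h` gives the radius `25 s` for `z`.
  have hsh : s * h ^ 2 = r ^ 2 / 16 := by
    rw [hh, div_pow, mul_pow, Real.sq_sqrt hspos.le]; field_simp; norm_num
  obtain ⟨z, hz0, hclose, hbound⟩ := exists_round L hhpos hcol x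
  set y : Fin n → ℝ := fun j => h * z j with hy
  have hys : y = h • fun j => (z j : ℝ) := rfl
  have hcard : ((supp x).card : ℝ) ≤ s := by exact_mod_cast hx
  have hdist : l2norm (y - x) ≤ r / 4 := by
    refine (sq_le_sq₀ (l2norm_nonneg _) (by positivity)).1 ?_
    rw [l2norm_sq]
    calc ∑ j, (y - x) j ^ 2 = ∑ j ∈ supp x, (y - x) j ^ 2 := by
          refine (Finset.sum_subset (Finset.subset_univ _) fun j _ hj => ?_).symm
          have h1 : x j = 0 := by simpa [mem_supp] using hj
          simp [hy, h1, hz0 j h1]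
      _ ≤ ∑ j ∈ supp x, h ^ 2 := Finset.sum_le_sum fun j _ => by
          rw [← sq_abs]
          have := hclose j
          gcongr
          exact this
      _ ≤ s * h ^ 2 := by
          rw [Finset.sum_const, nsmul_eq_mul]; gcongr
      _ = (r / 4) ^ 2 := by rw [hsh]; ring
  have hlow : 3 / 4 * r ≤ l2norm y := by
    have := norm_sub_norm_le (WithLp.toLp 2 x) (WithLp.toLp 2 y)
    rw [norm_sub_rev, ← WithLp.toLp_sub] at this
    change r - l2norm y ≤ l2norm (y - x) at this
    linarith
  have hup : l2norm y ≤ 5 / 4 * r := by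
    have := norm_sub_norm_le (WithLp.toLp 2 y) (WithLp.toLp 2 x)
    rw [← WithLp.toLp_sub] at this
    change l2norm y - r ≤ l2norm (y - x) at this
    linarith
  have hyz : l2norm y ^ 2 = h ^ 2 * ∑ j, (z j : ℝ) ^ 2 := by
    rw [l2norm_sq, Finset.mul_sum]
    exact Finset.sum_congr rfl fun j _ => by rw [hy]; ring
  have hzmem : z ∈ sparseIntegerVectors n s (25 * s) := by
    refine mem_sparseIntegerVectors.2 ⟨le_trans (Finset.card_le_card fun j hj => ?_) hx, ?_⟩
    · simp only [Finset.mem_filter, Finset.mem_univ, true_and] at hj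
      exact mem_supp.2 fun h0 => hj (hz0 j h0)
    · have h1 : h ^ 2 * ∑ j, (z j : ℝ) ^ 2 ≤ h ^ 2 * (25 * s) := by
        rw [← hyz]
        calc l2norm y ^ 2 ≤ (5 / 4 * r) ^ 2 := by
              gcongr
              exact l2norm_nonneg _
          _ = h ^ 2 * (25 * s) := by linear_combination -25 * hsh
      have h2 := le_of_mul_le_mul_left h1 (by positivity)
      exact_mod_cast h2
  have hLz := hnet z hzmem
  have hLy : 1 / 4 * l2norm y ^ 2 ≤ ‖L y‖ ^ 2 := by
    rw [hyz, hys, map_smul, norm_smul, mul_pow, Real.norm_eq_abs, sq_abs]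
    nlinarith [sq_nonneg h]
  have h3 : (3 / 4 * r) ^ 2 ≤ l2norm y ^ 2 := by gcongr
  have h4 : ((supp x).card : ℝ) * (4 * h ^ 2 / 4) ≤ s * h ^ 2 := by
    rw [mul_div_cancel_left₀ _ (four_ne_zero' ℝ)]; gcongr
  -- The constant is `(1 / 4) (3 / 4)² - 1 / 16 = 5 / 64`.
  linarith

end Rounding

/-! ### Counting sparse integer vectors. -/

section Counting

theorem sum_Icc_half_pow_natAbs (M : ℕ) :
    ∑ z ∈ Finset.Icc (-(M : ℤ)) M, (1 / 2 : ℝ) ^ z.natAbs = 3 - 2 * (1 / 2) ^ M := by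
  induction M with
  | zero => norm_num
  | succ M ih =>
    have h : Finset.Icc (-((M + 1 : ℕ) : ℤ)) ((M + 1 : ℕ) : ℤ) =
        insert (-((M + 1 : ℕ) : ℤ)) (insert ((M + 1 : ℕ) : ℤ) (Finset.Icc (-(M : ℤ)) M)) := by
      ext z; simp only [Finset.mem_Icc, Finset.mem_insert]; push_cast; omega
    rw [h, Finset.sum_insert, Finset.sum_insert, ih, Int.natAbs_neg, Int.natAbs_natCast, pow_succ]
    · ring
    · simp
    · simp only [Finset.mem_insert, Finset.mem_Icc]; push_cast; omega

/-- A generating function argument: weight a nonzero entry `z` by `q 2 ^ (-|z|)`. Every counted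
vector has weight at least `q ^ s 2 ^ (-R)`, because `∑ |z j| ≤ ∑ z j ^ 2 ≤ R`, while the total
weight is at most `(1 + 2 q) ^ n`. -/
theorem card_sparseIntegerVectors_le (n s R : ℕ) {q : ℝ} (hq : 0 < q) (hq1 : q ≤ 1) :
    ((sparseIntegerVectors n s R).card : ℝ) ≤ (1 / q) ^ s * 2 ^ R * Real.exp (2 * q * n) := by
  set w : ℤ → ℝ := fun z => if z = 0 then 1 else q * (1 / 2) ^ z.natAbs with hw
  have hw0 : ∀ z, 0 ≤ w z := fun z => by
    simp only [hw]; split_ifs <;> positivity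
  have hone : ∑ z ∈ Finset.Icc (-(R : ℤ)) R, w z ≤ 1 + 2 * q := by
    have hmem : (0 : ℤ) ∈ Finset.Icc (-(R : ℤ)) R := by simp
    have h1 := sum_Icc_half_pow_natAbs R
    rw [← Finset.add_sum_erase _ _ hmem] at h1 ⊢
    have h2 : ∑ z ∈ (Finset.Icc (-(R : ℤ)) R).erase 0, w z =
        q * ∑ z ∈ (Finset.Icc (-(R : ℤ)) R).erase 0, (1 / 2 : ℝ) ^ z.natAbs := by
      rw [Finset.mul_sum]
      exact Finset.sum_congr rfl fun z hz => by simp [hw, (Finset.mem_erase.1 hz).1]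
    rw [h2]
    have h3 : (0 : ℝ) < (1 / 2) ^ R := by positivity
    have h4 : w 0 = 1 := by simp [hw]
    simp only [Int.natAbs_zero, pow_zero] at h1
    rw [h4]
    nlinarith
  have hlow : ∀ z ∈ sparseIntegerVectors n s R, q ^ s * (1 / 2) ^ R ≤ ∏ j, w (z j) := by
    intro z hz
    obtain ⟨hcard, hsum⟩ := mem_sparseIntegerVectors.1 hz
    have hprod : ∏ j, w (z j) =
        q ^ (Finset.univ.filter fun j => z j ≠ 0).card * (1 / 2) ^ ∑ j, (z j).natAbs := by
      rw [← Finset.prod_pow_eq_pow_sum, ← Finset.prod_const, Finset.prod_filter,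
        ← Finset.prod_mul_distrib]
      refine Finset.prod_congr rfl fun j _ => ?_
      by_cases h0 : z j = 0 <;> simp [hw, h0]
    have habs : ∑ j, (z j).natAbs ≤ R := by
      have : ((∑ j, (z j).natAbs : ℕ) : ℤ) ≤ R := by
        push_cast
        refine le_trans (Finset.sum_le_sum fun j _ => ?_) hsum
        rw [← sq_abs]
        exact Int.le_self_sq _
      exact_mod_cast this
    rw [hprod]
    exact mul_le_mul (pow_le_pow_of_le_one hq.le hq1 hcard)
      (pow_le_pow_of_le_one (by norm_num) (by norm_num) habs) (by positivity) (by positivity)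
  have htotal : ((sparseIntegerVectors n s R).card : ℝ) * (q ^ s * (1 / 2) ^ R) ≤
      Real.exp (2 * q * n) := by
    rw [← nsmul_eq_mul, ← Finset.sum_const]
    calc _ ≤ ∑ z ∈ sparseIntegerVectors n s R, ∏ j, w (z j) := Finset.sum_le_sum hlow
      _ ≤ ∑ z ∈ Fintype.piFinset fun _ : Fin n => Finset.Icc (-(R : ℤ)) R, ∏ j, w (z j) :=
          Finset.sum_le_sum_of_subset_of_nonneg (Finset.filter_subset _ _)
            fun _ _ _ => Finset.prod_nonneg fun _ _ => hw0 _
      _ = (∑ z ∈ Finset.Icc (-(R : ℤ)) R, w z) ^ n := by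
          rw [← Finset.prod_univ_sum]; simp
      _ ≤ (1 + 2 * q) ^ n := by
          gcongr
      _ ≤ Real.exp (2 * q) ^ n := by
          gcongr; rw [add_comm]; exact Real.add_one_le_exp _
      _ = Real.exp (2 * q * n) := by rw [← Real.exp_nat_mul]; congr 1; ring
  have hpos : 0 < q ^ s * (1 / 2 : ℝ) ^ R := by positivity
  rw [← le_div_iff₀ hpos] at htotal
  refine htotal.trans (le_of_eq ?_)
  simp only [one_div, inv_pow]
  field_simp

end Counting

/-! ### The scale `k log (n / k)`. -/

section SparsityScale

variable {n k : ℕ}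

theorem three_le_log_div (hk : 1 ≤ k) (hn : 1 ≤ n) (hkn : (k : ℝ) / n ≤ 0.04) :
    3 ≤ Real.log ((n : ℝ) / k) := by
  have hk0 : (0 : ℝ) < k := by exact_mod_cast hk
  have hn0 : (0 : ℝ) < n := by exact_mod_cast hn
  rw [Real.le_log_iff_exp_le (by positivity)]
  have h1 : (25 : ℝ) ≤ n / k := by
    rw [div_le_iff₀ hn0] at hkn
    rw [le_div_iff₀ hk0]
    linarith
  have h2 : Real.exp 3 = Real.exp 1 ^ 3 := by rw [← Real.exp_nat_mul]; norm_num
  have h3 : Real.exp 1 ^ 3 ≤ 2.72 ^ 3 := by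
    gcongr; linarith [Real.exp_one_lt_d9]
  rw [h2]
  refine h3.trans (le_trans ?_ h1)
  norm_num

/-- Write `log n = log (n / k) + log k` and use `log k ≤ k - 1`. This makes `exp (-k log (n / k))`
at most `1 / n`, even for bounded `k`. -/
theorem log_le_mul_log_div (hk : 1 ≤ k) (hn : 1 ≤ n) (hkn : (k : ℝ) / n ≤ 0.04) :
    Real.log n ≤ k * Real.log ((n : ℝ) / k) := by
  have hk0 : (0 : ℝ) < k := by exact_mod_cast hk
  have hn0 : (0 : ℝ) < n := by exact_mod_cast hn
  have h3 := three_le_log_div hk hn hkn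
  have hk1 : (1 : ℝ) ≤ k := by exact_mod_cast hk
  have h4 := Real.log_le_sub_one_of_pos hk0
  have h5 : Real.log n = Real.log ((n : ℝ) / k) + Real.log k := by
    rw [Real.log_div hn0.ne' hk0.ne', sub_add_cancel]
  rw [h5]
  nlinarith

/-- The first entropy term is exactly `k log (n / k)`; the second lies between `0` and `n q = k`,
which is absorbed since `log (n / k) ≥ 3`. -/
theorem mul_binEntropy_bounds (hk : 1 ≤ k) (hn : 1 ≤ n) (hkn : (k : ℝ) / n ≤ 0.04) :
    (k : ℝ) * Real.log ((n : ℝ) / k) ≤ n * Real.binEntropy ((k : ℝ) / n) ∧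
      n * Real.binEntropy ((k : ℝ) / n) ≤ 2 * ((k : ℝ) * Real.log ((n : ℝ) / k)) := by
  have hk0 : (0 : ℝ) < k := by exact_mod_cast hk
  have hn0 : (0 : ℝ) < n := by exact_mod_cast hn
  have h3 := three_le_log_div hk hn hkn
  set q := (k : ℝ) / n with hq
  have hq0 : 0 < q := by positivity
  have hnq : n * q = k := by rw [hq]; field_simp
  have hqinv : q⁻¹ = n / k := by rw [hq, inv_div]
  have hpos : 0 < 1 - q := by linarith
  have hent : n * Real.binEntropy q =
      k * Real.log (n / k) + n * ((1 - q) * Real.log (1 - q)⁻¹) := by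
    rw [Real.binEntropy, hqinv, mul_add, ← mul_assoc, hnq]
  have hlow : 0 ≤ Real.log (1 - q)⁻¹ :=
    Real.log_nonneg ((one_le_inv₀ hpos).2 (by linarith))
  have hup : (1 - q) * Real.log (1 - q)⁻¹ ≤ q := by
    have := Real.log_le_sub_one_of_pos (inv_pos.2 hpos)
    calc _ ≤ (1 - q) * ((1 - q)⁻¹ - 1) := by gcongr
      _ = q := by rw [mul_sub, mul_inv_cancel₀ hpos.ne']; ring
  rw [hent]
  constructor
  · have : 0 ≤ n * ((1 - q) * Real.log (1 - q)⁻¹) := by positivity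
    linarith
  · have : n * ((1 - q) * Real.log (1 - q)⁻¹) ≤ n * q := by gcongr
    nlinarith

end SparsityScale

/-! ### Lower isometry and recovery for Gaussian matrices. -/

section GaussianMatrix

theorem card_sparseIntegerVectors_le_exp {n k : ℕ} (hk : 1 ≤ k) (hn : 1 ≤ n)
    (hkn : (k : ℝ) / n ≤ 0.04) :
    ((sparseIntegerVectors n (2 * k) (25 * (2 * k))).card : ℝ) ≤
      Real.exp (20 * (k * Real.log ((n : ℝ) / k))) := by
  have hk0 : (0 : ℝ) < k := by exact_mod_cast hk
  have hn0 : (0 : ℝ) < n := by exact_mod_cast hn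
  have h3 := three_le_log_div hk hn hkn
  refine (card_sparseIntegerVectors_le n (2 * k) (25 * (2 * k)) (q := (k : ℝ) / n)
    (by positivity) (hkn.trans (by norm_num))).trans ?_
  have h2 : (2 : ℝ) ≤ Real.exp 1 := by linarith [Real.exp_one_gt_d9]
  have hnk : (1 / ((k : ℝ) / n)) = Real.exp (Real.log (n / k)) := by
    rw [one_div_div, Real.exp_log (by positivity)]
  have h2k : (2 : ℝ) ^ (25 * (2 * k)) ≤ Real.exp 1 ^ (25 * (2 * k)) := by gcongr
  calc _ ≤ Real.exp (Real.log (n / k)) ^ (2 * k) * Real.exp 1 ^ (25 * (2 * k)) *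
        Real.exp (2 * (k / n) * n) := by rw [hnk]; gcongr
    _ = Real.exp (2 * (k * Real.log (n / k)) + 52 * k) := by
        rw [← Real.exp_nat_mul, ← Real.exp_nat_mul, ← Real.exp_add, ← Real.exp_add]
        congr 1
        push_cast
        field_simp
        ring
    _ ≤ _ := by
        refine Real.exp_le_exp.2 ?_
        -- As `log (n / k) ≥ 3`, the term `52 k` is at most `18 k log (n / k)`.
        nlinarith

/-- Gaussian matrices satisfy the lower restricted isometry property with high probability. -/
theorem gaussianEnsemble_not_lowerRIP_le {n k m : ℕ} (hk : 1 ≤ k) (hn : 1 ≤ n)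
    (hkn : (k : ℝ) / n ≤ 0.04) (hm : 84 * ((k : ℝ) * Real.log ((n : ℝ) / k)) ≤ m) :
    gaussianEnsemble m n {G | ¬ LowerRIP (sensingMap (Matrix.of G)) (2 * k) (5 / 64)} ≤
      ENNReal.ofReal (2 / n) := by
  classical
  have hk0 : (0 : ℝ) < k := by exact_mod_cast hk
  have hn0 : (0 : ℝ) < n := by exact_mod_cast hn
  have h3 := three_le_log_div hk hn hkn
  have hlog := log_le_mul_log_div hk hn hkn
  have hl0 : 0 < (k : ℝ) * Real.log ((n : ℝ) / k) := by positivity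
  have hcard := card_sparseIntegerVectors_le_exp hk hn hkn
  set l := (k : ℝ) * Real.log ((n : ℝ) / k)
  have hm0 : 0 < m := by
    have : (0 : ℝ) < m := by linarith
    exact_mod_cast this
  set Z := sparseIntegerVectors n (2 * k) (25 * (2 * k)) with hZ
  set δ := Real.exp (-((m : ℝ) / 4)) with hδ
  set A : Set (Fin m → Fin n → ℝ) := ⋃ j ∈ (Finset.univ : Finset (Fin n)),
    {G | 4 * ∑ i, (Pi.single j (1 : ℝ) : Fin n → ℝ) i ^ 2 ≤
      ‖sensingMap (Matrix.of G) (Pi.single j 1)‖ ^ 2} with hA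
  -- The zero vector is removed because its event would be certain.
  set B : Set (Fin m → Fin n → ℝ) := ⋃ z ∈ Z.erase 0,
    {G | ‖sensingMap (Matrix.of G) (fun j => (z j : ℝ))‖ ^ 2 ≤
      1 / 4 * ∑ j, (z j : ℝ) ^ 2} with hB
  have hsingle : ∀ j : Fin n, ∑ i, (Pi.single j (1 : ℝ) : Fin n → ℝ) i ^ 2 = 1 := fun j => by
    simp [Pi.single_apply]
  have hsub : {G : Fin m → Fin n → ℝ | ¬ LowerRIP (sensingMap (Matrix.of G)) (2 * k) (5 / 64)} ⊆
      A ∪ B := by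
    intro G hG
    by_contra hAB
    rw [Set.mem_union, not_or] at hAB
    simp only [hA, hB, Set.mem_iUnion, Set.mem_ofPred_eq, not_exists, not_le, Finset.mem_univ,
      hsingle, forall_const, mul_one, Finset.mem_erase] at hAB
    refine hG (lowerRIP_of_sparseIntegerVectors _ (fun j => (hAB.1 j).le) fun z hz => ?_)
    by_cases hz0 : z = 0
    · subst hz0; simp
    · exact (hAB.2 z ⟨hz0, hz⟩).le
  have hPA : gaussianEnsemble m n A ≤ ENNReal.ofReal (n * δ) := by
    refine (measure_biUnion_finset_le _ _).trans ((Finset.sum_le_sum fun j _ =>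
      gaussianEnsemble_norm_sq_ge hm0 (by rw [hsingle]; exact one_pos)).trans ?_)
    rw [Finset.sum_const, Finset.card_univ, Fintype.card_fin, ← ENNReal.ofReal_nsmul,
      nsmul_eq_mul]
  have hPB : gaussianEnsemble m n B ≤ ENNReal.ofReal (Z.card * δ) := by
    refine (measure_biUnion_finset_le _ _).trans ((Finset.sum_le_sum fun z hz =>
      gaussianEnsemble_norm_sq_le hm0 ?_).trans ?_)
    · obtain ⟨j, hj⟩ := Function.ne_iff.1 (Finset.mem_erase.1 hz).1
      refine Finset.sum_pos' (fun _ _ => sq_nonneg _) ⟨j, Finset.mem_univ j, ?_⟩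
      have : (z j : ℝ) ≠ 0 := by exact_mod_cast hj
      positivity
    · rw [Finset.sum_const, ← ENNReal.ofReal_nsmul, nsmul_eq_mul]
      refine ENNReal.ofReal_le_ofReal ?_
      gcongr
      exact Finset.erase_subset _ _
  refine (measure_mono hsub).trans ((measure_union_le _ _).trans
    ((add_le_add hPA hPB).trans ?_))
  rw [← ENNReal.ofReal_add (by positivity) (by positivity)]
  refine ENNReal.ofReal_le_ofReal ?_
  -- The constant `84 = 4 * 21` leaves one factor `exp (-l)` after paying `exp (20 l)` for the net.
  have hδl : δ ≤ Real.exp (-(21 * l)) := Real.exp_le_exp.2 (by linarith)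
  have hexpl : Real.exp (-l) ≤ 1 / n := by
    rw [Real.exp_neg, one_div]
    gcongr
    exact (Real.log_le_iff_le_exp hn0).1 hlog
  have h1 : n * δ ≤ 1 / n := by
    refine le_trans ?_ hexpl
    calc (n : ℝ) * δ ≤ Real.exp l * Real.exp (-(21 * l)) := by
          gcongr
          exact (Real.log_le_iff_le_exp hn0).1 hlog
      _ ≤ Real.exp (-l) := by
          rw [← Real.exp_add]; exact Real.exp_le_exp.2 (by linarith)
  have h2 : Z.card * δ ≤ 1 / n := by
    refine le_trans ?_ hexpl
    calc (Z.card : ℝ) * δ ≤ Real.exp (20 * l) * Real.exp (-(21 * l)) := by gcongr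
      _ = Real.exp (-l) := by rw [← Real.exp_add]; congr 1; ring
  calc _ ≤ 1 / (n : ℝ) + 1 / n := add_le_add h1 h2
    _ = 2 / n := by ring

/-- Neither `A` nor `f` is assumed measurable: `A` is shrunk to the complement of a measurable hull
of `Aᶜ`, which keeps the probability bound. -/
theorem mul_ofReal_le_lintegral {Ω : Type*} [MeasurableSpace Ω] (μ : Measure Ω)
    [IsProbabilityMeasure μ] {A : Set Ω} {δ : ℝ} (h : μ Aᶜ ≤ ENNReal.ofReal δ) (hδ : 0 ≤ δ)
    {f : Ω → ℝ≥0∞} {p : ℝ≥0∞} (hf : ∀ ω ∈ A, p ≤ f ω) :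
    p * ENNReal.ofReal (1 - δ) ≤ ∫⁻ ω, f ω ∂μ := by
  set B := (toMeasurable μ Aᶜ)ᶜ with hB
  have hBA : B ⊆ A := Set.compl_subset_comm.1 (subset_toMeasurable μ Aᶜ)
  have hBm : MeasurableSet B := (measurableSet_toMeasurable μ Aᶜ).compl
  have hμB : ENNReal.ofReal (1 - δ) ≤ μ B :=
    ofReal_one_sub_le_of_compl_le μ (by rw [hB, compl_compl, measure_toMeasurable]; exact h) hδ
  calc p * ENNReal.ofReal (1 - δ) ≤ p * μ B := by gcongr
    _ = ∫⁻ ω, B.indicator (fun _ => p) ω ∂μ := (lintegral_indicator_const hBm p).symm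
    _ ≤ ∫⁻ ω, f ω ∂μ := lintegral_mono fun ω => by
        by_cases hω : ω ∈ B
        · simp [hω, hf ω (hBA hω)]
        · simp [hω]

theorem ofReal_one_sub_le_lintegral_worstCaseRecoveryProb {n k m : ℕ} {β SNR : ℝ} (hk : 1 ≤ k)
    (hn : 2 ≤ n) (hkn : (k : ℝ) / n ≤ 0.04)
    (hm : 84 * ((k : ℝ) * Real.log ((n : ℝ) / k)) ≤ m) (hβ : 0 < β)
    (hSNR : 128 / (5 / 64) * Real.log n / β ^ 2 ≤ SNR) :
    ENNReal.ofReal (1 - 6 / n) ≤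
      ∫⁻ G, worstCaseRecoveryProb (Matrix.of G) k β SNR ∂(gaussianEnsemble m n) := by
  have : IsProbabilityMeasure (gaussianEnsemble m n) := by
    unfold gaussianEnsemble; infer_instance
  have hn2 : (2 : ℝ) ≤ n := by exact_mod_cast hn
  have hn0 : (0 : ℝ) < n := by linarith
  have h := mul_ofReal_le_lintegral (gaussianEnsemble m n)
    (A := {G | LowerRIP (sensingMap (Matrix.of G)) (2 * k) (5 / 64)})
    (gaussianEnsemble_not_lowerRIP_le hk (by omega) hkn hm) (by positivity)
    (f := fun G => worstCaseRecoveryProb (Matrix.of G) k β SNR)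
    (fun G hG => ofReal_one_sub_le_worstCaseRecoveryProb hG (by norm_num) hβ hn hSNR)
  refine le_trans ?_ h
  have h2 : 0 ≤ 1 - 2 / (n : ℝ) := by
    rw [sub_nonneg, div_le_one hn0]; exact hn2
  rw [← ENNReal.ofReal_mul' h2]
  refine ENNReal.ofReal_le_ofReal ?_
  -- What remains is `(1 - 4 / n) (1 - 2 / n) ≥ 1 - 6 / n`.
  have h3 : (0 : ℝ) < 1 / n := by positivity
  have h4 : (4 : ℝ) / n = 4 * (1 / n) := by ring
  have h5 : (2 : ℝ) / n = 2 * (1 / n) := by ring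
  have h6 : (6 : ℝ) / n = 6 * (1 / n) := by ring
  rw [h4, h5, h6]
  nlinarith

end GaussianMatrix

/-! ### Assembly of the theorem. -/

theorem eventually_div_le (a : ℝ) {ε : ℝ} (hε : 0 < ε) :
    ∀ᶠ n : ℕ in atTop, a / n ≤ ε :=
  ((tendsto_const_div_atTop_nhds_zero_nat a).eventually_lt_const hε).mono fun _ h => h.le

theorem theorem3p2 :
    -- the two forms of the measurement scaling have the same order
    (∀ n k : ℕ, 1 ≤ k → (k : ℝ) / n ≤ 0.04 → 1 ≤ n →
      (k : ℝ) * Real.log ((n : ℝ) / k) ≤ n * Real.binEntropy ((k : ℝ) / n) ∧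
      n * Real.binEntropy ((k : ℝ) / n) ≤ 2 * ((k : ℝ) * Real.log ((n : ℝ) / k))) ∧
    -- Gaussian sensing matrices
    (∃ C₁ : ℝ, 0 < C₁ ∧ ∃ C₂ : ℝ, 0 < C₂ ∧ ∀ ε : ℝ, 0 < ε →
      ∀ᶠ n : ℕ in atTop, ∀ (k m : ℕ) (β SNR : ℝ),
        1 ≤ k → (k : ℝ) / n ≤ 0.04 →
        C₁ * ((k : ℝ) * Real.log ((n : ℝ) / k)) ≤ m →
        0 < β → C₂ * Real.log n / β ^ 2 ≤ SNR →
        ENNReal.ofReal (1 - ε) ≤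
          ∫⁻ G, worstCaseRecoveryProb (Matrix.of G) k β SNR ∂(gaussianEnsemble m n)) ∧
    -- deterministic sensing matrices
    (∀ c : ℝ, 0 < c → ∃ C : ℝ, 0 < C ∧ ∀ ε : ℝ, 0 < ε →
      ∀ᶠ n : ℕ in atTop, ∀ (k m : ℕ) (β SNR : ℝ) (G : Matrix (Fin m) (Fin n) ℝ),
        1 ≤ k → 2 * k + 1 ≤ m →
        (∀ j : Fin n, l2norm (fun i => G i j) = 1) →
        c ≤ sigmaMin G k →
        0 < β → C * Real.log n / β ^ 2 ≤ SNR →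
        ENNReal.ofReal (1 - ε) ≤ worstCaseRecoveryProb G k β SNR) := by
  refine ⟨fun n k hk hkn hn => mul_binEntropy_bounds hk hn hkn,
    ⟨84, by norm_num, 128 / (5 / 64), by norm_num, fun ε hε => ?_⟩,
    fun c hc => ⟨128 / c, by positivity, fun ε hε => ?_⟩⟩
  · filter_upwards [eventually_div_le 6 hε, eventually_ge_atTop 2] with n hnε hn
    intro k m β SNR hk hkn hm hβ hSNR
    exact (ENNReal.ofReal_le_ofReal (by linarith)).trans
      (ofReal_one_sub_le_lintegral_worstCaseRecoveryProb hk hn hkn hm hβ hSNR)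
  · filter_upwards [eventually_div_le 4 hε, eventually_ge_atTop 2] with n hnε hn
    intro k m β SNR G _ _ _ hG hβ hSNR
    exact (ENNReal.ofReal_le_ofReal (by linarith)).trans
      (ofReal_one_sub_le_worstCaseRecoveryProb (lowerRIP_of_le_sigmaMin hG) hc hβ hn hSNR)
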